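/- Let $f^1,\dots,f^{k_0}\colon \mathbb{C}\times\mathbb{C}^n\to\mathbb{C}$ be non-constant polynomial functions with $f^k(t,\mathbf 0)=0$ for all $t$; write $f^k_t(\mathbf z)=f^k(t,\mathbf z)$ and $f_t=f^1_t\cdots f^{k_0}_t$. For a polynomial $g=\sum_\alpha c_\alpha\mathbf z^\alpha$ on $\mathbb{C}^n$, let $\Gamma_+(g)$ be the convex hull of $\bigcup_{c_\alpha\ne0}(\alpha+\mathbb{R}_+^n)$, and let the Newton boundary $\Gamma(g)$ be the union of the compact faces of $\Gamma_+(g)$. For $\mathbf w\in\mathbb{N}^n\setminus\{\mathbf 0\}$, let $g_{\mathbf w}$ be the sum of those terms $c_\alpha\mathbf z^\alpha$ of $g$ whose exponent $\alpha$ lies in the face of $\Gamma_+(g)$ on which $\mathbf x\mapsto\sum_i w_ix_i$ is minimal. For $I\subseteq\{1,\dots,n\}$ put $\mathbb{C}^I=\{\mathbf z\in\mathbb{C}^n : z_i=0 \text{ for } i\notin I\}$. A finite set $\{g^1,\dots,g^p\}$ of polynomials is called *non-degenerate* if for every $\mathbf w$ with all $w_i>0$ the differentials $dg^1_{\mathbf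 w},\dots,dg^p_{\mathbf w}$ are linearly independent at every common zero of $g^1_{\mathbf w},\dots,g^p_{\mathbf w}$ in $(\mathbb{C}^*)^n$. A number $R>0$ is a *radius of local tameness* of $\{g^1,\dots,g^p\}$ if for every non-empty $I\subseteq\{1,\dots,n\}$ such that $g^1,\dots,g^p$ all vanish identically on $\mathbb{C}^I$, every $\mathbf w\in\mathbb{N}^n\setminus\{\mathbf 0\}$ with $\{i : w_i=0\}=I$, and all non-zero complex numbers $u_i$ ($i\in I$) with $\sum_{i\in I}|u_i|^2<R$, the functions $g^1_{\mathbf w},\dots,g^p_{\mathbf w}$, restricted to $\{\mathbf z\in(\mathbb{C}^*)^n : z_i=u_i \text{ for } i\in I\}$ and regarded as functions of the variables $z_i$, $i\notin I$, have linearly independent differentials at each of their common zeros. The family $\{f_t\}_t$ is *Newton-admissible* if there is $R>0$ such that for all sufficiently small $t$: (a) for every $k$, the Newton boundary $\Gamma(f^k_t)$ is independent of $t$; (b) for every non-empty $\{k_1,\dots,k_p\}\subseteq\{1,\dots,k_0\}$, the set $\{f^{k_1}_t,\dots,f^{k_p}_t\}$ is non-degenerate; (c) for every non-empty $\{k_1,\dots,k_p\}\subseteq\{1,\dots,k_0\}$,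 the set $\{f^{k_1}_t,\dots,f^{k_p}_t\}$ has a radius of local tameness greater than $R$. **Proposition.** If $\{f_t\}_t$ is Newton-admissible, then there exist $\delta,\tau,r>0$ such that for all $\eta\in\mathbb{C}$ with $0<|\eta|\le\delta$ and all $t\in\mathbb{C}$ with $|t|\le\tau$, the level hypersurface $V(f_t-\eta)=\{\mathbf z\in\mathbb{C}^n : f_t(\mathbf z)=\eta\}$ is non-singular in the open ball $\mathring B_r$ of radius $r$ centred at the origin of $\mathbb{C}^n$, that is, $df_t(\mathbf z)\ne0$ at every point $\mathbf z\in V(f_t-\eta)\cap\mathring B_r$. The same conclusion holds if only (a) and (b) are assumed for all sufficiently small $t$. -/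

import Mathlib

open scoped Topology

noncomputable section

namespace Newton

variable {n : ℕ}

/-- The Newton polyhedron `Γ₊(f)`: the convex hull of the union of the sets `α + ℝ₊ⁿ` over the
exponents `α` of the monomials of `f`. -/
def polyhedron (f : MvPolynomial (Fin n) ℂ) : Set (Fin n → ℝ) :=
  convexHull ℝ (⋃ α ∈ f.support, {x : Fin n → ℝ | ∀ i, (α i : ℝ) ≤ x i})

/-- The Newton boundary `Γ(f)`: the union of the compact faces of `Γ₊(f)`. -/
def boundary (f : MvPolynomial (Fin n) ℂ) : Set (Fin n → ℝ) :=
  ⋃₀ {B | IsExposed ℝ (polyhedron f) B ∧ IsCompact B}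

/-- The face `Δ(w; f)` of `Γ₊(f)` on which the linear form `x ↦ ∑ wᵢ xᵢ` is minimal. -/
def face (w : Fin n → ℕ) (f : MvPolynomial (Fin n) ℂ) : Set (Fin n → ℝ) :=
  {x ∈ polyhedron f | ∀ y ∈ polyhedron f, ∑ i, (w i : ℝ) * x i ≤ ∑ i, (w i : ℝ) * y i}

open Classical in
/-- The face function `f_w`: the sum of the terms `c_α z^α` of `f` with `α ∈ Δ(w; f)`. -/
def faceFunction (w : Fin n → ℕ) (f : MvPolynomial (Fin n) ℂ) : MvPolynomial (Fin n) ℂ :=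
  ∑ α ∈ f.support with (fun i => (α i : ℝ)) ∈ face w f, MvPolynomial.monomial α (f.coeff α)

/-- `I ∈ 𝒱_f`: the restriction of `f` to the coordinate subspace `ℂ^I` vanishes identically. -/
def IsVanishing (f : MvPolynomial (Fin n) ℂ) (I : Finset (Fin n)) : Prop :=
  ∀ z : Fin n → ℂ, (∀ i, i ∉ I → z i = 0) → MvPolynomial.eval z f = 0

variable {k₀ : ℕ}

/-- The germ at `0` of the common zero set of the `g k`, `k ∈ K`, is a non-degenerate complete
intersection variety: for every positive weight vector `w`, the differentials of the face functions
`(g k)_w`, `k ∈ K`, are linearly independent (that is, their wedge product is non-zero) at every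
common zero of these face functions in the torus `(ℂ*)ⁿ`. -/
def IsNonDegenerate (g : Fin k₀ → MvPolynomial (Fin n) ℂ) (K : Finset (Fin k₀)) : Prop :=
  ∀ w : Fin n → ℕ, (∀ i, 0 < w i) →
    ∀ z : Fin n → ℂ, (∀ i, z i ≠ 0) →
      (∀ k ∈ K, MvPolynomial.eval z (faceFunction w (g k)) = 0) →
      LinearIndependent ℂ fun (k : K) (i : Fin n) =>
        MvPolynomial.eval z (MvPolynomial.pderiv i (faceFunction w (g k)))

/-- `R` is a radius of local tameness of the set of functions `g k`, `k ∈ K`: for every non-empty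
`I` in all the `𝒱_{g k}`, every non-zero weight vector `w` whose zero weights are exactly those
with index in `I`, and every choice of non-zero values `z i`, `i ∈ I`, with
`∑_{i ∈ I} |z i|² < R`, the face functions `(g k)_w`, regarded as functions of the remaining
variables `z i`, `i ∉ I`, have linearly independent differentials at each of their common zeros
with non-zero coordinates. -/
def IsTameRadius (g : Fin k₀ → MvPolynomial (Fin n) ℂ) (K : Finset (Fin k₀)) (R : ℝ) : Prop :=
  0 < R ∧ ∀ I : Finset (Fin n), I.Nonempty → (∀ k ∈ K, IsVanishing (g k) I) →
    ∀ w : Fin n → ℕ, w ≠ 0 → (∀ i, w i = 0 ↔ i ∈ I) →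
      ∀ z : Fin n → ℂ, (∀ i, z i ≠ 0) → ∑ i ∈ I, ‖z i‖ ^ 2 < R →
        (∀ k ∈ K, MvPolynomial.eval z (faceFunction w (g k)) = 0) →
        LinearIndependent ℂ fun (k : K) (i : {i : Fin n // i ∉ I}) =>
          MvPolynomial.eval z (MvPolynomial.pderiv i.1 (faceFunction w (g k)))

/-- A polynomial function on `ℂ × ℂⁿ` is a polynomial in `z` whose coefficients are polynomials
in `t`; `member f t` is the polynomial `f_t(z) = f(t, z)`. -/
def member (f : MvPolynomial (Fin n) (Polynomial ℂ)) (t : ℂ) : MvPolynomial (Fin n) ℂ :=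
  MvPolynomial.map (Polynomial.evalRingHom t) f

/-- For all small `t`, the Newton boundary of each `f^k_t` is independent of `t`. -/
def HasConstantBoundary (f : Fin k₀ → MvPolynomial (Fin n) (Polynomial ℂ)) : Prop :=
  ∀ᶠ t in 𝓝 (0 : ℂ), ∀ k, boundary (member (f k) t) = boundary (member (f k) 0)

/-- For all small `t`, every subset of the functions `f^k_t` defines a germ of a non-degenerate
complete intersection variety. -/
def IsNonDegenerateFamily (f : Fin k₀ → MvPolynomial (Fin n) (Polynomial ℂ)) : Prop :=
  ∀ᶠ t in 𝓝 (0 : ℂ), ∀ K : Finset (Fin k₀), K.Nonempty →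
    IsNonDegenerate (fun k => member (f k) t) K

/-- For all small `t`, every subset of the functions `f^k_t` has a radius of local tameness
which is greater than some `R > 0` independent of `t` and of the subset. -/
def IsUniformlyTame (f : Fin k₀ → MvPolynomial (Fin n) (Polynomial ℂ)) : Prop :=
  ∃ R : ℝ, 0 < R ∧ ∀ᶠ t in 𝓝 (0 : ℂ), ∀ K : Finset (Fin k₀), K.Nonempty →
    ∃ R' : ℝ, R < R' ∧ IsTameRadius (fun k => member (f k) t) K R'

/-- The family of products `f_t = f^1_t ⋯ f^{k₀}_t` is Newton-admissible. -/
def IsAdmissible (f : Fin k₀ → MvPolynomial (Fin n) (Polynomial ℂ)) : Prop :=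
  HasConstantBoundary f ∧ IsNonDegenerateFamily f ∧ IsUniformlyTame f

/-- The hypersurface `V(g)` is non-singular in `U`: the differential of `g` does not vanish at any
point of `V(g) ∩ U`. -/
def IsNonsingularIn (g : MvPolynomial (Fin n) ℂ) (U : Set (EuclideanSpace ℂ (Fin n))) : Prop :=
  ∀ z ∈ U, MvPolynomial.eval z.ofLp g = 0 →
    ∃ i, MvPolynomial.eval z.ofLp (MvPolynomial.pderiv i g) ≠ 0

/-- The nearby fibres `V(f_t - η)`, `η ≠ 0`, of the products `f_t = f^1_t ⋯ f^{k₀}_t` are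
non-singular near the origin, uniformly in `t`. -/
def HasUniformlyNonsingularFibres (f : Fin k₀ → MvPolynomial (Fin n) (Polynomial ℂ)) : Prop :=
  ∃ δ τ r : ℝ, 0 < δ ∧ 0 < τ ∧ 0 < r ∧
    ∀ η t : ℂ, 0 < ‖η‖ → ‖η‖ ≤ δ → ‖t‖ ≤ τ →
      IsNonsingularIn (member (∏ k, f k) t - MvPolynomial.C η)
        (Metric.ball (0 : EuclideanSpace ℂ (Fin n)) r)

end Newton

end

open scoped Topology Pointwise

namespace Newton

/-! ### Newton polyhedra, faces and weights -/

variable {n : ℕ}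

/-! If the conclusion fails, an ultrafilter of points `(t, z)` tends to the origin along which
`f_t(z) ≠ 0` and `df_t(z) = 0`. It plays the role of an analytic arc from the curve selection lemma:
it yields a positive weight vector `w` and a torus point `a` such that, after scaling, `f^k_t(z)`
and `z_i ∂_i f^k_t(z)` tend to the values at `a` of the face function `(f^k_0)_w` and of its
logarithmic derivatives (`HasConstantBoundary.exists_leading_terms`). The lattice of Laurent
monomials with non-zero limit produces `a` (`exists_torus_point`) and `w` (`exists_weight`);
constancy of the Newton boundary prevents exponents that are present only for `t ≠ 0` from having
smaller weight.

Dividing the differential of the product by the product gives `∑ df^k/f^k = 0`. Multiplying by the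
smallest scaled factor, of index `k₁`, and passing to the limit gives a relation with coefficients
`ρ k` among the differentials at `a`, where `ρ k₁ = 1`. If the face function of index `k₁` vanishes
at `a`, only indices with vanishing face functions contribute, against non-degeneracy at `t = 0`.
Otherwise Euler's identity forces the minimal weights to sum to zero, so `f^{k₁}_0` has a constant
term, against `f^{k₁}_0(0) = 0`. Tameness plays no role. -/

/-- A non-negative linear form is bounded below on the Newton polyhedron by its minimum over the
exponents. -/
theorem le_sum_of_mem_polyhedron (w : Fin n → ℕ) (f : MvPolynomial (Fin n) ℂ) (d : ℝ)
    (h : ∀ β ∈ f.support, d ≤ ∑ i, (w i : ℝ) * (β i : ℝ)) {y : Fin n → ℝ}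
    (hy : y ∈ polyhedron f) : d ≤ ∑ i, (w i : ℝ) * y i := by
  have hconv : Convex ℝ {y : Fin n → ℝ | d ≤ ∑ i, (w i : ℝ) * y i} := by
    apply convex_halfSpace_ge
    exact ⟨fun x y => by simp [mul_add, Finset.sum_add_distrib],
      fun c x => by simp [Finset.mul_sum, mul_left_comm]⟩
  refine convexHull_min ?_ hconv hy
  intro x hx
  simp only [Set.mem_iUnion, Set.mem_ofPred_eq] at hx ⊢
  obtain ⟨β, hβ, hx⟩ := hx
  refine (h β hβ).trans (Finset.sum_le_sum fun i _ => ?_)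
  exact mul_le_mul_of_nonneg_left (hx i) (Nat.cast_nonneg _)

theorem coe_mem_polyhedron {f : MvPolynomial (Fin n) ℂ} {β : Fin n →₀ ℕ} (hβ : β ∈ f.support) :
    (fun i => (β i : ℝ)) ∈ polyhedron f := by
  apply subset_convexHull
  simp only [Set.mem_iUnion, Set.mem_ofPred_eq]
  exact ⟨β, hβ, fun i => le_rfl⟩

theorem coe_mem_face_iff (w : Fin n → ℕ) {f : MvPolynomial (Fin n) ℂ} {α : Fin n →₀ ℕ}
    (hα : α ∈ f.support) :
    (fun i => (α i : ℝ)) ∈ face w f ↔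
      ∀ β ∈ f.support, ∑ i, w i * α i ≤ ∑ i, w i * β i := by
  constructor
  · intro h β hβ
    have := h.2 _ (coe_mem_polyhedron hβ)
    beta_reduce at this
    exact_mod_cast this
  · intro h
    refine ⟨coe_mem_polyhedron hα, fun y hy => le_sum_of_mem_polyhedron w f _ ?_ hy⟩
    intro β hβ
    beta_reduce
    exact_mod_cast h β hβ

theorem faceFunction_eq (w : Fin n → ℕ) (f : MvPolynomial (Fin n) ℂ) :
    faceFunction w f = ∑ α ∈ f.support with ∀ β ∈ f.support, ∑ i, w i * α i ≤ ∑ i, w i * β i,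
      MvPolynomial.monomial α (f.coeff α) := by
  unfold faceFunction
  refine Finset.sum_congr ?_ fun _ _ => rfl
  ext α
  simp only [Finset.mem_filter]
  exact and_congr_right fun hα => coe_mem_face_iff w hα

/-- The polyhedron is the Minkowski sum of a compact polytope and the closed positive orthant. -/
theorem isClosed_polyhedron (f : MvPolynomial (Fin n) ℂ) : IsClosed (polyhedron f) := by
  have hfin : (Set.image (fun (α : Fin n →₀ ℕ) (i : Fin n) => (α i : ℝ)) f.support).Finite :=
    f.support.finite_toSet.image _
  have heq : polyhedron f =
      convexHull ℝ (Set.image (fun (α : Fin n →₀ ℕ) (i : Fin n) => (α i : ℝ)) f.support) +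
        Set.Ici (0 : Fin n → ℝ) := by
    rw [← (convex_Ici (𝕜 := ℝ) (0 : Fin n → ℝ)).convexHull_eq, ← convexHull_add, polyhedron]
    congr 1
    ext x
    simp only [Set.mem_iUnion, Set.mem_ofPred_eq, Set.mem_add, Set.mem_image, Set.mem_Ici,
      exists_exists_and_eq_and]
    constructor
    · rintro ⟨α, hα, hx⟩
      refine ⟨α, hα, x - fun i => (α i : ℝ), ?_, by simp⟩
      intro i
      simpa using hx i
    · rintro ⟨α, hα, y, hy, rfl⟩
      exact ⟨α, hα, fun i => by simpa using hy i⟩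
  rw [heq]
  exact isClosed_Ici.add_left_of_isCompact (Set.Finite.isCompact_convexHull ℝ hfin)

theorem isExposed_face (w : Fin n → ℕ) (f : MvPolynomial (Fin n) ℂ) :
    IsExposed ℝ (polyhedron f) (face w f) := by
  intro _
  refine ⟨-∑ i, (w i : ℝ) • ContinuousLinearMap.proj (R := ℝ) (φ := fun _ : Fin n => ℝ) i, ?_⟩
  ext x
  simp [face]

/-- Coordinates on the polyhedron are non-negative, so positive integral weights bound each of them
by the minimal value of the form. -/
theorem isCompact_face {w : Fin n → ℕ} (hw : ∀ i, 0 < w i) (f : MvPolynomial (Fin n) ℂ) :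
    IsCompact (face w f) := by
  rcases (face w f).eq_empty_or_nonempty with h | ⟨p, hp⟩
  · rw [h]; exact isCompact_empty
  have hnonneg : ∀ y ∈ polyhedron f, ∀ i, 0 ≤ y i := by
    intro y hy i
    have := le_sum_of_mem_polyhedron (Pi.single i 1) f 0 (fun β _ => by positivity) hy
    simpa [Pi.single_apply] using this
  have hclosed : IsClosed (face w f) :=
    (isExposed_face w f).isClosed (isClosed_polyhedron f)
  refine (isCompact_Icc (a := (0 : Fin n → ℝ))
    (b := fun _ => ∑ i, (w i : ℝ) * p i)).of_isClosed_subset hclosed ?_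
  intro x hx
  refine ⟨fun i => hnonneg x hx.1 i, fun i => ?_⟩
  refine le_trans ?_ (hx.2 p hp.1)
  have h1 : (w i : ℝ) * x i ≤ ∑ j, (w j : ℝ) * x j :=
    Finset.single_le_sum (f := fun j => (w j : ℝ) * x j)
      (fun j _ => mul_nonneg (Nat.cast_nonneg _) (hnonneg x hx.1 j)) (Finset.mem_univ i)
  have h2 : (1 : ℝ) ≤ w i := by exact_mod_cast hw i
  nlinarith [hnonneg x hx.1 i]

/-- If two polynomials have the same Newton boundary, then no exponent of the first has smaller
weight, for a positive weight vector, than all the exponents of the second. -/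
theorem exists_mem_support_sum_le_of_boundary_eq {f g : MvPolynomial (Fin n) ℂ}
    (h : boundary f = boundary g) {w : Fin n → ℕ} (hw : ∀ i, 0 < w i) {α : Fin n →₀ ℕ}
    (hα : α ∈ f.support) : ∃ β ∈ g.support, ∑ i, w i * β i ≤ ∑ i, w i * α i := by
  obtain ⟨γ, hγ, hmin⟩ := f.support.exists_min_image (fun β => ∑ i, w i * β i) ⟨α, hα⟩
  have hface : (fun i => (γ i : ℝ)) ∈ face w f := (coe_mem_face_iff w hγ).2 hmin
  have hb : (fun i => (γ i : ℝ)) ∈ boundary g := by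
    rw [← h]
    exact ⟨_, ⟨isExposed_face w f, isCompact_face hw f⟩, hface⟩
  obtain ⟨B, ⟨hB, -⟩, hmem⟩ := hb
  have hpoly := hB.subset hmem
  by_contra! hcon
  -- Weights of exponents are integers, so a strict inequality leaves a gap of 1.
  have := le_sum_of_mem_polyhedron w g (((∑ i, w i * γ i : ℕ) : ℝ) + 1) (fun β hβ => by
    have : ∑ i, w i * γ i + 1 ≤ ∑ i, w i * β i := lt_of_le_of_lt (hmin α hα) (hcon β hβ)
    exact_mod_cast this) hpoly
  push_cast at this
  linarith

theorem coeff_member (f : MvPolynomial (Fin n) (Polynomial ℂ)) (t : ℂ) (α : Fin n →₀ ℕ) :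
    (member f t).coeff α = (f.coeff α).eval t := by
  simp [member, MvPolynomial.coeff_map]

/-- The coefficient of `α` is a non-zero polynomial in `t`, so `α` is an exponent of some member
with `t` small and non-zero, whose boundary is that of the central member. -/
theorem HasConstantBoundary.exists_mem_support_sum_le {k₀ : ℕ}
    {f : Fin k₀ → MvPolynomial (Fin n) (Polynomial ℂ)} (hf : HasConstantBoundary f) (k : Fin k₀)
    {w : Fin n → ℕ} (hw : ∀ i, 0 < w i) {α : Fin n →₀ ℕ} (hα : α ∈ (f k).support) :
    ∃ β ∈ (member (f k) 0).support, ∑ i, w i * β i ≤ ∑ i, w i * α i := by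
  have hne : ∀ᶠ t in 𝓝[≠] (0 : ℂ), ((f k).coeff α).eval t ≠ 0 := by
    have hfin : {t : ℂ | ((f k).coeff α).IsRoot t}.Finite :=
      Polynomial.finite_setOfPred_isRoot (MvPolynomial.mem_support_iff.1 hα)
    have h1 : ∀ᶠ t in 𝓝[≠] (0 : ℂ), t ∈ ({t : ℂ | ((f k).coeff α).IsRoot t} \ {0})ᶜ := by
      apply mem_nhdsWithin_of_mem_nhds
      exact (hfin.subset Set.sdiff_subset).isClosed.isOpen_compl.mem_nhds (by simp)
    filter_upwards [h1, self_mem_nhdsWithin] with t ht ht0 h0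
    exact ht ⟨h0, ht0⟩
  obtain ⟨t, ht1, ht2⟩ := (hne.and (nhdsWithin_le_nhds hf)).exists
  refine exists_mem_support_sum_le_of_boundary_eq (ht2 k) hw ?_
  rw [MvPolynomial.mem_support_iff, coeff_member]
  exact ht1

open Filter

/-! ### Laurent monomials -/

section Laurent

variable {ι : Type*} [Fintype ι]

/-- The Laurent monomial with exponent `m`, evaluated at `u`. -/
noncomputable def laurent (u : ι → ℂ) (m : ι → ℤ) : ℂ := ∏ i, u i ^ m i

theorem laurent_ne_zero {u : ι → ℂ} (hu : ∀ i, u i ≠ 0) (m : ι → ℤ) : laurent u m ≠ 0 :=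
  Finset.prod_ne_zero_iff.2 fun i _ => zpow_ne_zero _ (hu i)

theorem laurent_zero (u : ι → ℂ) : laurent u 0 = 1 := by simp [laurent]

theorem laurent_add {u : ι → ℂ} (hu : ∀ i, u i ≠ 0) (m m' : ι → ℤ) :
    laurent u (m + m') = laurent u m * laurent u m' := by
  simp [laurent, zpow_add₀ (hu _), Finset.prod_mul_distrib]

theorem laurent_neg (u : ι → ℂ) (m : ι → ℤ) : laurent u (-m) = (laurent u m)⁻¹ := by
  simp [laurent, zpow_neg]

theorem laurent_sub {u : ι → ℂ} (hu : ∀ i, u i ≠ 0) (m m' : ι → ℤ) :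
    laurent u (m - m') = laurent u m / laurent u m' := by
  rw [sub_eq_add_neg, laurent_add hu, laurent_neg, div_eq_mul_inv]

theorem laurent_smul (u : ι → ℂ) (c : ℤ) (m : ι → ℤ) :
    laurent u (c • m) = laurent u m ^ c := by
  simp only [laurent, Pi.smul_apply, smul_eq_mul, ← Finset.prod_zpow]
  exact Finset.prod_congr rfl fun i _ => by rw [mul_comm, zpow_mul]

theorem laurent_sum_smul {u : ι → ℂ} (hu : ∀ i, u i ≠ 0) {κ : Type*} (s : Finset κ) (c : κ → ℤ)
    (v : κ → ι → ℤ) : laurent u (∑ j ∈ s, c j • v j) = ∏ j ∈ s, laurent u (v j) ^ c j := by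
  classical
  induction s using Finset.induction_on with
  | empty => simp [laurent_zero]
  | insert j s hj ih =>
    rw [Finset.sum_insert hj, Finset.prod_insert hj, laurent_add hu, ih, laurent_smul]

theorem laurent_single [DecidableEq ι] (u : ι → ℂ) (i : ι) :
    laurent u (Pi.single i 1) = u i := by
  rw [laurent, Finset.prod_eq_single i] <;> simp +contextual

end Laurent

/-! ### Limits of Laurent monomials along an ultrafilter -/

/-- Along an ultrafilter, a complex function either converges or is unbounded. -/
theorem tendsto_or_tendsto_inv_zero {X : Type*} (𝒰 : Ultrafilter X) (g : X → ℂ) :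
    (∃ c, Tendsto g 𝒰 (𝓝 c)) ∨ Tendsto (fun x => (g x)⁻¹) 𝒰 (𝓝 0) := by
  by_cases h : ∃ B : ℝ, ∀ᶠ x in (𝒰 : Filter X), g x ∈ Metric.closedBall (0 : ℂ) B
  · obtain ⟨B, hB⟩ := h
    obtain ⟨c, -, hc⟩ := (isCompact_closedBall (0 : ℂ) B).ultrafilter_le_nhds (𝒰.map g)
      (le_principal_iff.2 hB)
    exact Or.inl ⟨c, hc⟩
  · right
    push Not at h
    refine tendsto_inv₀_cobounded.comp (tendsto_norm_atTop_iff_cobounded.1 ?_)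
    refine tendsto_atTop.2 fun B => ?_
    filter_upwards [h B] with x hx
    simp only [Metric.mem_closedBall, dist_zero_right, not_le] at hx
    exact hx.le

section Exponents

variable {ι : Type*} [Fintype ι] {X : Type*} (𝒰 : Ultrafilter X) {u : X → ι → ℂ}
  (hu : ∀ x i, u x i ≠ 0)

/-- The exponents of the Laurent monomials that have a non-zero limit along an ultrafilter. -/
def balancedExponents : Submodule ℤ (ι → ℤ) where
  carrier := {m | ∃ c ≠ 0, Tendsto (fun x => laurent (u x) m) 𝒰 (𝓝 c)}
  zero_mem' := ⟨1, one_ne_zero, by simp only [laurent_zero]; exact tendsto_const_nhds⟩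
  add_mem' := by
    rintro m m' ⟨c, hc, h⟩ ⟨c', hc', h'⟩
    refine ⟨c * c', mul_ne_zero hc hc', ?_⟩
    simpa only [laurent_add (hu _)] using h.mul h'
  smul_mem' := by
    rintro k m ⟨c, hc, h⟩
    refine ⟨c ^ k, zpow_ne_zero _ hc, ?_⟩
    simpa only [laurent_smul] using h.zpow₀ k (Or.inl hc)

theorem laurent_trichotomy (m : ι → ℤ) : m ∈ balancedExponents 𝒰 hu ∨
    Tendsto (fun x => laurent (u x) m) 𝒰 (𝓝 0) ∨
    Tendsto (fun x => laurent (u x) (-m)) 𝒰 (𝓝 0) := by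
  rcases tendsto_or_tendsto_inv_zero 𝒰 (fun x => laurent (u x) m) with ⟨c, hc⟩ | h
  · by_cases h0 : c = 0
    · exact Or.inr (Or.inl (h0 ▸ hc))
    · exact Or.inl ⟨c, h0, hc⟩
  · right; right
    simpa only [laurent_neg] using h

theorem not_mem_balancedExponents_of_tendsto_zero {m : ι → ℤ}
    (h : Tendsto (fun x => laurent (u x) m) 𝒰 (𝓝 0)) : m ∉ balancedExponents 𝒰 hu := by
  rintro ⟨c, hc, h'⟩
  exact hc (tendsto_nhds_unique h' h)

/-- Saturation of the sublattice: this makes the quotient torsion-free, hence free, so that it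
splits off. -/
theorem mem_balancedExponents_of_nsmul_mem {m : ι → ℤ} {k : ℕ} (hk : k ≠ 0)
    (h : k • m ∈ balancedExponents 𝒰 hu) : m ∈ balancedExponents 𝒰 hu := by
  have key : ∀ m : ι → ℤ, Tendsto (fun x => laurent (u x) m) 𝒰 (𝓝 0) →
      k • m ∉ balancedExponents 𝒰 hu := by
    intro m hm
    apply not_mem_balancedExponents_of_tendsto_zero
    have := hm.pow k
    rw [zero_pow hk] at this
    refine this.congr fun x => ?_
    rw [← natCast_zsmul, laurent_smul, zpow_natCast]
  rcases laurent_trichotomy 𝒰 hu m with h1 | h1 | h1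
  · exact h1
  · exact absurd h (key m h1)
  · refine absurd ?_ (key _ h1)
    rw [smul_neg]
    exact neg_mem h

/-- The balanced exponents form a direct summand of the lattice of all exponents. -/
theorem exists_projection_balancedExponents : ∃ π : (ι → ℤ) →ₗ[ℤ] (ι → ℤ),
    (∀ m, m - π m ∈ balancedExponents 𝒰 hu) ∧ ∀ m ∈ balancedExponents 𝒰 hu, π m = 0 := by
  set L := balancedExponents 𝒰 hu
  have htf : IsAddTorsionFree ((ι → ℤ) ⧸ L) := by
    refine ⟨fun k hk x y hxy => ?_⟩
    obtain ⟨m, rfl⟩ := L.mkQ_surjective x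
    obtain ⟨m', rfl⟩ := L.mkQ_surjective y
    have h1 : L.mkQ (k • m) = L.mkQ (k • m') := by
      rw [map_nsmul, map_nsmul]; exact hxy
    refine (Submodule.Quotient.eq L).2 (mem_balancedExponents_of_nsmul_mem 𝒰 hu hk ?_)
    rw [smul_sub]
    exact (Submodule.Quotient.eq L).1 h1
  obtain ⟨s, hs⟩ := Module.projective_lifting_property L.mkQ LinearMap.id L.mkQ_surjective
  refine ⟨s ∘ₗ L.mkQ, fun m => ?_, fun m hm => ?_⟩
  · refine (Submodule.Quotient.eq L).1 ?_
    exact (LinearMap.congr_fun hs (L.mkQ m)).symm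
  · simp [(Submodule.Quotient.mk_eq_zero L).2 hm]

/-- The limits of the balanced Laurent monomials are their values at a point of the torus. -/
theorem exists_torus_point : ∃ a : ι → ℂ, (∀ i, a i ≠ 0) ∧ ∀ m ∈ balancedExponents 𝒰 hu,
    Tendsto (fun x => laurent (u x) m) 𝒰 (𝓝 (laurent a m)) := by
  classical
  obtain ⟨π, hπ, hπ0⟩ := exists_projection_balancedExponents 𝒰 hu
  choose a ha hlim using fun i => hπ (Pi.single i 1)
  refine ⟨a, ha, fun m hm => ?_⟩
  -- Since `π m = 0`, `m` is a combination of the balanced vectors `e_i - π e_i`; the coordinates of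
  -- `a` are the limits of their monomials.
  have hsum : m = ∑ i, m i • (Pi.single i 1 - π (Pi.single i 1)) := by
    have hm1 : ∑ i, m i • (Pi.single i 1 : ι → ℤ) = m := by
      ext j
      simp [Finset.sum_apply, Pi.single_apply]
    simp only [smul_sub, Finset.sum_sub_distrib, ← map_smul, ← map_sum, hm1, hπ0 m hm, sub_zero]
  have h1 : Tendsto (fun x => ∏ i, laurent (u x) (Pi.single i 1 - π (Pi.single i 1)) ^ m i) 𝒰
      (𝓝 (∏ i, a i ^ m i)) :=
    tendsto_finsetProd _ fun i _ => (hlim i).zpow₀ _ (Or.inl (ha i))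
  refine h1.congr fun x => ?_
  rw [← laurent_sum_smul (hu x), ← hsum]

/-- Finitely many Laurent monomials that tend to zero along an ultrafilter have positive weight
for an integral weight vector for which all balanced Laurent monomials have weight zero. -/
theorem exists_weight (F : Finset (ι → ℤ))
    (hF : ∀ m ∈ F, Tendsto (fun x => laurent (u x) m) 𝒰 (𝓝 0)) :
    ∃ w : ι → ℤ, (∀ m ∈ balancedExponents 𝒰 hu, ∑ i, w i * m i = 0) ∧
      ∀ m ∈ F, 0 < ∑ i, w i * m i := by
  classical
  obtain ⟨π, hπ, hπ0⟩ := exists_projection_balancedExponents 𝒰 hu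
  -- The monomials of `m` and `π m` differ by a factor with a non-zero limit, so the latter also
  -- tends to zero.
  have hev : ∀ᶠ x in (𝒰 : Filter X), ∀ m ∈ F, ‖laurent (u x) (π m)‖ < 1 := by
    refine (Filter.eventually_all_finset F).2 fun m hm => ?_
    obtain ⟨c, hc, hlim⟩ := hπ m
    have h1 := (hF m hm).div hlim hc
    rw [zero_div] at h1
    have h2 := h1.norm.eventually (gt_mem_nhds (by simp : ‖(0 : ℂ)‖ < 1))
    filter_upwards [h2] with x hx
    rw [Pi.div_apply, ← laurent_sub (hu x), sub_sub_cancel] at hx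
    exact hx
  obtain ⟨x, hx⟩ := hev.exists
  -- The vector of `log ‖u x i‖` at one point `x` solves these finitely many strict inequalities.
  -- They are open, so a rational solution exists; clearing denominators makes it integral.
  let U : Set (ι → ℝ) := {y | ∀ m ∈ F, ∑ i, (π m i : ℝ) * y i < 0}
  have hU : IsOpen U := by
    have : U = ⋂ m ∈ F, {y : ι → ℝ | ∑ i, (π m i : ℝ) * y i < 0} := by
      ext y; simp [U]
    rw [this]
    refine isOpen_biInter_finset fun m _ => isOpen_lt (by fun_prop) continuous_const
  have hmem : (fun i => Real.log ‖u x i‖) ∈ U := by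
    intro m hm
    have h1 := Real.log_neg (norm_pos_iff.2 (laurent_ne_zero (hu x) (π m))) (hx m hm)
    rw [laurent, norm_prod, Real.log_prod] at h1
    · simpa [Real.log_zpow] using h1
    · intro i _
      exact norm_ne_zero_iff.2 (zpow_ne_zero _ (hu x i))
  have hdense : DenseRange (fun (q : ι → ℚ) (i : ι) => (q i : ℝ)) :=
    DenseRange.piMap fun _ => Rat.denseRange_cast
  obtain ⟨q, hq⟩ := hdense.exists_mem_open hU ⟨_, hmem⟩
  obtain ⟨D, hD, p, hp⟩ : ∃ D : ℕ, 0 < D ∧ ∃ p : ι → ℤ, ∀ i, (p i : ℚ) = D * q i := by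
    refine ⟨∏ i, (q i).den, Finset.prod_pos fun i _ => (q i).den_pos,
      fun i => (∏ j ∈ Finset.univ.erase i, ((q j).den : ℤ)) * (q i).num, fun i => ?_⟩
    rw [← Finset.mul_prod_erase _ _ (Finset.mem_univ i)]
    push_cast
    rw [mul_right_comm, Rat.den_mul_eq_num, mul_comm]
  -- The weight is the form `m ↦ -p · π m`; factoring through `π` makes it vanish on balanced
  -- exponents.
  have hw : ∀ m, ∑ i, (-∑ j, p j * π (Pi.single i 1) j) * m i = -∑ j, p j * π m j := by
    intro m
    have hm1 : m = ∑ i, m i • (Pi.single i 1 : ι → ℤ) := by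
      ext j
      simp [Finset.sum_apply, Pi.single_apply]
    conv_rhs => rw [hm1]
    simp only [map_sum, map_smul, Finset.sum_apply, Pi.smul_apply, smul_eq_mul, Finset.mul_sum,
      neg_mul, Finset.sum_neg_distrib, Finset.sum_mul]
    rw [Finset.sum_comm]
    congr 1
    exact Finset.sum_congr rfl fun _ _ => Finset.sum_congr rfl fun _ _ => by ring
  refine ⟨fun i => -∑ j, p j * π (Pi.single i 1) j, fun m hm => ?_, fun m hm => ?_⟩
  · rw [hw, hπ0 m hm]; simp
  · rw [hw]
    have h1 : ∑ i, (π m i : ℚ) * q i < 0 := by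
      have := hq m hm
      beta_reduce at this
      exact_mod_cast this
    have h2 : ((∑ j, p j * π m j : ℤ) : ℚ) = D * ∑ i, (π m i : ℚ) * q i := by
      push_cast
      rw [Finset.mul_sum]
      exact Finset.sum_congr rfl fun i _ => by rw [hp]; ring
    have h3 : ((∑ j, p j * π m j : ℤ) : ℚ) < 0 := by
      rw [h2]
      exact mul_neg_of_pos_of_neg (by exact_mod_cast hD) h1
    have h4 : ∑ j, p j * π m j < 0 := by exact_mod_cast h3
    linarith

end Exponents

/-! ### Face functions and logarithmic derivatives -/

theorem coeff_faceFunction (w : Fin n → ℕ) (f : MvPolynomial (Fin n) ℂ) {α : Fin n →₀ ℕ}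
    (hα : α ∈ f.support) (hmin : ∀ β ∈ f.support, ∑ i, w i * α i ≤ ∑ i, w i * β i)
    (β : Fin n →₀ ℕ) : (faceFunction w f).coeff β =
      if ∑ i, w i * β i = ∑ i, w i * α i then f.coeff β else 0 := by
  classical
  rw [faceFunction_eq, MvPolynomial.coeff_sum]
  simp only [MvPolynomial.coeff_monomial, Finset.sum_ite_eq', Finset.mem_filter]
  by_cases hβ : β ∈ f.support
  · have : (∀ γ ∈ f.support, ∑ i, w i * β i ≤ ∑ i, w i * γ i) ↔
        ∑ i, w i * β i = ∑ i, w i * α i :=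
      ⟨fun h => le_antisymm (h α hα) (hmin β hβ), fun h γ hγ => h ▸ hmin γ hγ⟩
    simp only [hβ, true_and, this]
  · simp [hβ, MvPolynomial.notMem_support_iff.1 hβ]

theorem eval_eq_sum_of_support_subset (g : MvPolynomial (Fin n) ℂ) {S : Finset (Fin n →₀ ℕ)}
    (hS : g.support ⊆ S) (z : Fin n → ℂ) :
    MvPolynomial.eval z g = ∑ β ∈ S, g.coeff β * ∏ j, z j ^ β j := by
  rw [MvPolynomial.eval_eq']
  refine Finset.sum_subset hS fun β _ hβ => ?_
  rw [MvPolynomial.notMem_support_iff.1 hβ, zero_mul]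

/-- The operator `z_i ∂_i` only multiplies each monomial by its exponent, so limits of single terms
determine those of the derivatives; `S` permits an index set independent of `t`. -/
theorem mul_eval_pderiv_eq_sum (g : MvPolynomial (Fin n) ℂ) {S : Finset (Fin n →₀ ℕ)}
    (hS : g.support ⊆ S) (z : Fin n → ℂ) (i : Fin n) :
    z i * MvPolynomial.eval z (MvPolynomial.pderiv i g) =
      ∑ β ∈ S, (β i : ℂ) * (g.coeff β * ∏ j, z j ^ β j) := by
  have h1 : z i * MvPolynomial.eval z (MvPolynomial.pderiv i g) =
      ∑ β ∈ g.support, (β i : ℂ) * (g.coeff β * ∏ j, z j ^ β j) := by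
    conv_lhs => rw [g.as_sum]
    rw [map_sum, map_sum, Finset.mul_sum]
    refine Finset.sum_congr rfl fun β _ => ?_
    rw [MvPolynomial.pderiv_monomial, MvPolynomial.eval_monomial, Finsupp.prod_fintype _ _
      (fun _ => pow_zero _)]
    rcases Nat.eq_zero_or_pos (β i) with h0 | h0
    · simp [h0]
    · rw [← Finset.mul_prod_erase _ _ (Finset.mem_univ i),
        ← Finset.mul_prod_erase Finset.univ (fun j => z j ^ β j) (Finset.mem_univ i)]
      have h2 : ∏ j ∈ Finset.univ.erase i, z j ^ ((β - Finsupp.single i 1 : Fin n →₀ ℕ) j) =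
          ∏ j ∈ Finset.univ.erase i, z j ^ β j := by
        refine Finset.prod_congr rfl fun j hj => ?_
        simp [(Finset.ne_of_mem_erase hj)]
      rw [h2]
      have h3 : z i ^ β i = z i * z i ^ (β i - 1) := by
        rw [← pow_succ', Nat.sub_add_cancel h0]
      simp only [Finsupp.coe_tsub, Pi.sub_apply, Finsupp.single_eq_same, h3]
      ring
  rw [h1]
  refine Finset.sum_subset hS fun β _ hβ => ?_
  rw [MvPolynomial.notMem_support_iff.1 hβ, zero_mul, mul_zero]

/-- The Euler identity for face functions. -/
theorem sum_mul_eval_pderiv_faceFunction (w : Fin n → ℕ) (f : MvPolynomial (Fin n) ℂ)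
    {α : Fin n →₀ ℕ} (hα : α ∈ f.support)
    (hmin : ∀ β ∈ f.support, ∑ i, w i * α i ≤ ∑ i, w i * β i) (z : Fin n → ℂ) :
    ∑ i, (w i : ℂ) * (z i * MvPolynomial.eval z (MvPolynomial.pderiv i (faceFunction w f))) =
      ((∑ i, w i * α i : ℕ) : ℂ) * MvPolynomial.eval z (faceFunction w f) := by
  rw [eval_eq_sum_of_support_subset _ subset_rfl]
  simp only [mul_eval_pderiv_eq_sum _ subset_rfl, Finset.mul_sum]
  rw [Finset.sum_comm]
  refine Finset.sum_congr rfl fun β hβ => ?_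
  have h1 : ∑ i, w i * β i = ∑ i, w i * α i := by
    by_contra hne
    rw [MvPolynomial.mem_support_iff, coeff_faceFunction w f hα hmin, if_neg hne] at hβ
    exact hβ rfl
  rw [← h1]
  push_cast
  rw [Finset.sum_mul]
  exact Finset.sum_congr rfl fun i _ => by ring

theorem eval_pderiv_prod {κ : Type*} (s : Finset κ) (g : κ → MvPolynomial (Fin n) ℂ)
    (z : Fin n → ℂ) (hg : ∀ k ∈ s, MvPolynomial.eval z (g k) ≠ 0) (i : Fin n) :
    MvPolynomial.eval z (MvPolynomial.pderiv i (∏ k ∈ s, g k)) =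
      MvPolynomial.eval z (∏ k ∈ s, g k) *
        ∑ k ∈ s, MvPolynomial.eval z (MvPolynomial.pderiv i (g k)) /
          MvPolynomial.eval z (g k) := by
  classical
  induction s using Finset.induction_on with
  | empty => simp
  | insert k s hk ih =>
    have h1 := ih fun j hj => hg j (Finset.mem_insert_of_mem hj)
    have h2 := hg k (Finset.mem_insert_self _ _)
    rw [Finset.prod_insert hk, Finset.sum_insert hk, MvPolynomial.pderiv_mul, map_add, map_mul,
      map_mul, map_mul, h1]
    field_simp

/-- Along an ultrafilter, one of finitely many non-zero functions has convergent ratios with all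
the others. -/
theorem exists_tendsto_div {X κ : Type*} [Finite κ] [Nonempty κ] (𝒰 : Ultrafilter X)
    (G : κ → X → ℂ) (hG : ∀ᶠ x in (𝒰 : Filter X), ∀ k, G k x ≠ 0) :
    ∃ k₁, ∃ ρ : κ → ℂ, ρ k₁ = 1 ∧
      ∀ k, Tendsto (fun x => G k₁ x / G k x) 𝒰 (𝓝 (ρ k)) := by
  -- The index of the smallest function depends on `x`, but an ultrafilter selects one of finitely
  -- many.
  have h1 : ∀ᶠ x in (𝒰 : Filter X), ∃ k₁, ∀ k, ‖G k₁ x‖ ≤ ‖G k x‖ :=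
    Eventually.of_forall fun x => Finite.exists_min fun k => ‖G k x‖
  obtain ⟨k₁, hk₁⟩ := (Ultrafilter.eventually_exists_iff).1 h1
  have h2 : ∀ k, ∃ c, Tendsto (fun x => G k₁ x / G k x) 𝒰 (𝓝 c) := by
    intro k
    obtain ⟨c, -, hc⟩ := (isCompact_closedBall (0 : ℂ) 1).ultrafilter_le_nhds
      (𝒰.map fun x => G k₁ x / G k x) (le_principal_iff.2 (by
        change ∀ᶠ x in (𝒰 : Filter X), G k₁ x / G k x ∈ Metric.closedBall (0 : ℂ) 1
        filter_upwards [hk₁] with x hx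
        rw [mem_closedBall_zero_iff, norm_div]
        exact div_le_one_of_le₀ (hx k) (norm_nonneg _)))
    exact ⟨c, hc⟩
  choose ρ hρ using h2
  refine ⟨k₁, ρ, ?_, hρ⟩
  refine tendsto_nhds_unique (hρ k₁) (tendsto_const_nhds.congr' ?_)
  filter_upwards [hG] with x hx
  rw [div_self (hx k₁)]

/-! ### Leading terms along an ultrafilter -/

theorem support_member_subset (f : MvPolynomial (Fin n) (Polynomial ℂ)) (t : ℂ) :
    (member f t).support ⊆ f.support :=
  MvPolynomial.support_map_subset _ _

/-- The leading terms of a family with constant Newton boundary along an ultrafilter that tends to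
the origin are given by face functions of the central member. -/
theorem HasConstantBoundary.exists_leading_terms {k₀ : ℕ}
    {f : Fin k₀ → MvPolynomial (Fin n) (Polynomial ℂ)} (hf : HasConstantBoundary f)
    {X : Type*} (𝒰 : Ultrafilter X) (t : X → ℂ) (z : X → Fin n → ℂ)
    (ht : Tendsto t 𝒰 (𝓝 0)) (hz : ∀ i, Tendsto (fun x => z x i) 𝒰 (𝓝 0))
    (hne : ∀ᶠ x in (𝒰 : Filter X), ∀ k, MvPolynomial.eval (z x) (member (f k) (t x)) ≠ 0) :
    ∃ (w : Fin n → ℕ) (a : Fin n → ℂ) (α : Fin k₀ → Fin n →₀ ℕ) (s : Fin k₀ → X → ℂ),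
      (∀ i, 0 < w i) ∧ (∀ i, a i ≠ 0) ∧ (∀ k x, s k x ≠ 0) ∧
      (∀ k, α k ∈ (member (f k) 0).support) ∧
      (∀ k, ∀ β ∈ (member (f k) 0).support, ∑ i, w i * α k i ≤ ∑ i, w i * β i) ∧
      ∀ k, ∀ β ∈ (f k).support,
        Tendsto (fun x => (member (f k) (t x)).coeff β * (∏ j, z x j ^ β j) / s k x) 𝒰
          (𝓝 ((faceFunction w (member (f k) 0)).coeff β * ∏ j, a j ^ β j)) := by
  classical
  let I : Finset (Fin n) := {i | ∀ᶠ x in (𝒰 : Filter X), z x i ≠ 0}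
  have hI : ∀ i, i ∈ I ↔ ∀ᶠ x in (𝒰 : Filter X), z x i ≠ 0 := fun i => by simp [I]
  have hIc : ∀ i, i ∉ I → ∀ᶠ x in (𝒰 : Filter X), z x i = 0 := by
    intro i hi
    rw [hI, ← Ultrafilter.eventually_not] at hi
    simpa using hi
  -- Zero coordinates are replaced by 1 to stay in the torus; monomials in the variables of `I` are
  -- eventually unaffected.
  let u : X → Fin n → ℂ := fun x i => if z x i = 0 then 1 else z x i
  have hu : ∀ x i, u x i ≠ 0 := by
    intro x i
    by_cases h : z x i = 0 <;> simp [u, h]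
  have hz0 : ∀ᶠ x in (𝒰 : Filter X), ∀ i, (i ∈ I → z x i = u x i) ∧
      (i ∉ I → z x i = 0 ∧ u x i = 1) := by
    rw [eventually_all]
    intro i
    by_cases hi : i ∈ I
    · filter_upwards [(hI i).1 hi] with x hx
      simp [hi, u, hx]
    · filter_upwards [hIc i hi] with x hx
      simp [hi, u, hx]
  let e : (Fin n →₀ ℕ) → Fin n → ℤ := fun β i => (β i : ℤ)
  have hlaurent : ∀ (v : Fin n → ℂ) (β : Fin n →₀ ℕ), laurent v (e β) = ∏ j, v j ^ β j := by
    intro v β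
    simp [laurent, e]
  -- the exponents whose monomials tend to zero
  let F : Finset (Fin n → ℤ) :=
    ((Finset.univ.biUnion fun k => ((f k).support ×ˢ (f k).support).image fun p =>
      e p.1 - e p.2).filter fun m => Tendsto (fun x => laurent (u x) m) 𝒰 (𝓝 0)) ∪
      I.image fun i => Pi.single i 1
  have hF : ∀ m ∈ F, Tendsto (fun x => laurent (u x) m) 𝒰 (𝓝 0) := by
    intro m hm
    rcases Finset.mem_union.1 hm with hm | hm
    · exact (Finset.mem_filter.1 hm).2
    · obtain ⟨i, hi, rfl⟩ := Finset.mem_image.1 hm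
      refine (hz i).congr' ?_
      filter_upwards [hz0] with x hx
      rw [laurent_single, (hx i).1 hi]
  obtain ⟨w, hwL, hwF⟩ := exists_weight 𝒰 hu F hF
  obtain ⟨a, ha, hlim⟩ := exists_torus_point 𝒰 hu
  have hsub : ∀ k, ∀ β ∈ (f k).support, ∀ γ ∈ (f k).support,
      Tendsto (fun x => laurent (u x) (e β - e γ)) 𝒰 (𝓝 0) →
        0 < ∑ i, w i * (e β - e γ) i := by
    intro k β hβ γ hγ h
    refine hwF _ (Finset.mem_union_left _ (Finset.mem_filter.2 ⟨?_, h⟩))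
    exact Finset.mem_biUnion.2 ⟨k, Finset.mem_univ _, Finset.mem_image.2
      ⟨(β, γ), Finset.mem_product.2 ⟨hβ, hγ⟩, rfl⟩⟩
  have hwpos : ∀ i ∈ I, 0 < w i := by
    intro i hi
    have := hwF _ (Finset.mem_union_right _ (Finset.mem_image_of_mem _ hi))
    simpa [Pi.single_apply] using this
  -- a positive weight vector, large outside `I`
  let N : ℕ := 1 + ∑ k, ∑ β ∈ (f k).support, ∑ i, (w i).toNat * β i
  let w' : Fin n → ℕ := fun i => if i ∈ I then (w i).toNat else N
  have hw' : ∀ i, 0 < w' i := by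
    intro i
    by_cases hi : i ∈ I
    · simpa [w', hi] using hwpos i hi
    · simp [w', hi, N]
  have hin : ∀ β : Fin n →₀ ℕ, (∀ i, i ∉ I → β i = 0) →
      ((∑ i, w' i * β i : ℕ) : ℤ) = ∑ i, w i * e β i := by
    intro β hβ
    push_cast
    refine Finset.sum_congr rfl fun i _ => ?_
    by_cases hi : i ∈ I
    · simp [w', hi, e, (hwpos i hi).le]
    · simp [hβ i hi, e]
  have hlt : ∀ k, ∀ β ∈ (f k).support, (∀ i, i ∉ I → β i = 0) → ∑ i, w' i * β i < N := by
    intro k β hβ h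
    have h1 : ∑ i, w' i * β i = ∑ i, (w i).toNat * β i := by
      refine Finset.sum_congr rfl fun i _ => ?_
      by_cases hi : i ∈ I
      · simp [w', hi]
      · simp [h i hi]
    have h2 : ∑ i, (w i).toNat * β i ≤ ∑ β ∈ (f k).support, ∑ i, (w i).toNat * β i :=
      Finset.single_le_sum (f := fun β : Fin n →₀ ℕ => ∑ i, (w i).toNat * β i)
        (fun _ _ => Nat.zero_le _) hβ
    have h3 : ∑ β ∈ (f k).support, ∑ i, (w i).toNat * β i ≤
        ∑ k, ∑ β ∈ (f k).support, ∑ i, (w i).toNat * β i :=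
      Finset.single_le_sum (f := fun k => ∑ β ∈ (f k).support, ∑ i, (w i).toNat * β i)
        (fun _ _ => Nat.zero_le _) (Finset.mem_univ k)
    omega
  have hge : ∀ β : Fin n →₀ ℕ, ¬ (∀ i, i ∉ I → β i = 0) → N ≤ ∑ i, w' i * β i := by
    intro β h
    push Not at h
    obtain ⟨i, hi, hβ⟩ := h
    calc N ≤ w' i * β i := by
          simp only [w', hi, if_false]
          exact Nat.le_mul_of_pos_right _ (Nat.pos_of_ne_zero hβ)
      _ ≤ _ := Finset.single_le_sum (f := fun i => w' i * β i)
          (fun _ _ => Nat.zero_le _) (Finset.mem_univ i)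
  -- every member has a monomial in the variables indexed by `I`
  have hmono : ∀ k, ∃ β ∈ (f k).support, ∀ i, i ∉ I → β i = 0 := by
    intro k
    obtain ⟨x, hx, hx0⟩ := (hne.and hz0).exists
    by_contra! hcon
    refine hx k ?_
    rw [eval_eq_sum_of_support_subset _ (support_member_subset (f k) (t x))]
    refine Finset.sum_eq_zero fun β hβ => ?_
    obtain ⟨i, hi, hβi⟩ := hcon β hβ
    rw [Finset.prod_eq_zero (Finset.mem_univ i) (by rw [((hx0 i).2 hi).1, zero_pow hβi]),
      mul_zero]
  have hmin : ∀ k, ∃ α ∈ (member (f k) 0).support,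
      ∀ β ∈ (member (f k) 0).support, ∑ i, w' i * α i ≤ ∑ i, w' i * β i := by
    intro k
    obtain ⟨β, hβ, -⟩ := hmono k
    obtain ⟨γ, hγ, -⟩ := hf.exists_mem_support_sum_le k hw' hβ
    exact (member (f k) 0).support.exists_min_image (fun β => ∑ i, w' i * β i) ⟨γ, hγ⟩
  choose α hα hαmin using hmin
  have hαle : ∀ k, ∀ β ∈ (f k).support, ∑ i, w' i * α k i ≤ ∑ i, w' i * β i := by
    intro k β hβ
    obtain ⟨γ, hγ, hle⟩ := hf.exists_mem_support_sum_le k hw' hβ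
    exact (hαmin k γ hγ).trans hle
  have hαN : ∀ k, ∑ i, w' i * α k i < N := by
    intro k
    obtain ⟨β, hβ, hβI⟩ := hmono k
    exact (hαle k β hβ).trans_lt (hlt k β hβ hβI)
  have hαI : ∀ k, ∀ i, i ∉ I → α k i = 0 := by
    intro k
    by_contra h
    exact absurd (hge _ h) (not_le.2 (hαN k))
  -- The factor `laurent a (e (α k))` normalises the limits to monomials in `a` itself, rather than
  -- quotients by the leading one.
  refine ⟨w', a, α, fun k x => laurent (u x) (e (α k)) / laurent a (e (α k)), hw', ha,
    fun k x => div_ne_zero (laurent_ne_zero (hu x) _) (laurent_ne_zero ha _), hα, hαmin, ?_⟩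
  intro k β hβ
  have hαf : α k ∈ (f k).support := support_member_subset _ _ (hα k)
  rw [coeff_faceFunction w' _ (hα k) (hαmin k)]
  have hcoeff : Tendsto (fun x => (member (f k) (t x)).coeff β) 𝒰
      (𝓝 ((member (f k) 0).coeff β)) := by
    simp only [coeff_member]
    exact (((f k).coeff β).continuous.tendsto 0).comp ht
  by_cases hβI : ∀ i, i ∉ I → β i = 0
  · have hmain : ∀ c : ℂ, Tendsto (fun x => laurent (u x) (e β - e (α k))) 𝒰 (𝓝 c) →
        Tendsto (fun x => (member (f k) (t x)).coeff β * (∏ j, z x j ^ β j) /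
          (laurent (u x) (e (α k)) / laurent a (e (α k)))) 𝒰
          (𝓝 ((member (f k) 0).coeff β * (c * laurent a (e (α k))))) := by
      intro c hc
      refine (hcoeff.mul (hc.mul_const (laurent a (e (α k))))).congr' ?_
      filter_upwards [hz0] with x hx
      have h1 : ∏ j, z x j ^ β j = laurent (u x) (e β) := by
        rw [hlaurent]
        refine Finset.prod_congr rfl fun j _ => ?_
        by_cases hj : j ∈ I
        · rw [(hx j).1 hj]
        · rw [hβI j hj, pow_zero, pow_zero]
      rw [h1, laurent_sub (hu x)]
      field_simp
    have hdiff : ∑ i, w i * (e β - e (α k)) i =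
        ((∑ i, w' i * β i : ℕ) : ℤ) - ((∑ i, w' i * α k i : ℕ) : ℤ) := by
      rw [hin β hβI, hin _ (hαI k), ← Finset.sum_sub_distrib]
      exact Finset.sum_congr rfl fun i _ => by rw [Pi.sub_apply]; ring
    -- The cases are equal weight (on the face), larger weight (limit zero), and smaller weight,
    -- excluded by `hαle`.
    rcases laurent_trichotomy 𝒰 hu (e β - e (α k)) with h | h | h
    · have h1 := hwL _ h
      rw [hdiff] at h1
      rw [if_pos (by omega)]
      convert hmain _ (hlim _ h) using 3
      rw [laurent_sub ha, div_mul_cancel₀ _ (laurent_ne_zero ha _), hlaurent]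
    · have h1 := hsub k β hβ _ hαf h
      rw [hdiff] at h1
      rw [if_neg (by omega)]
      simpa using hmain _ h
    · rw [neg_sub] at h
      have h1 := hsub k _ hαf β hβ h
      have h2 := hαle k β hβ
      have h3 : ∑ i, w i * (e (α k) - e β) i = -∑ i, w i * (e β - e (α k)) i := by
        rw [← Finset.sum_neg_distrib]
        exact Finset.sum_congr rfl fun i _ => by rw [Pi.sub_apply, Pi.sub_apply]; ring
      rw [h3, hdiff] at h1
      omega
  · rw [if_neg (fun h => absurd (hge β hβI) (by have := hαN k; omega)), zero_mul]
    refine tendsto_const_nhds.congr' ?_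
    push Not at hβI
    obtain ⟨i, hi, hβi⟩ := hβI
    filter_upwards [hz0] with x hx
    rw [Finset.prod_eq_zero (Finset.mem_univ i) (by rw [((hx i).2 hi).1, zero_pow hβi]),
      mul_zero, zero_div]

/-! ### Excluding singular points near the origin -/

/-- The points near the origin that are singular in a fibre over a value close to, but different
from, zero. -/
def singularPoints {k₀ : ℕ} (f : Fin k₀ → MvPolynomial (Fin n) (Polynomial ℂ)) :
    Set (ℂ × EuclideanSpace ℂ (Fin n)) :=
  {x | MvPolynomial.eval x.2.ofLp (∏ k, member (f k) x.1) ≠ 0 ∧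
    ‖MvPolynomial.eval x.2.ofLp (∏ k, member (f k) x.1)‖ ≤ 1 / 2 ∧
    ∀ i, MvPolynomial.eval x.2.ofLp (MvPolynomial.pderiv i (∏ k, member (f k) x.1)) = 0}

theorem zero_notMem_closure_singularPoints {k₀ : ℕ}
    {f : Fin k₀ → MvPolynomial (Fin n) (Polynomial ℂ)}
    (hzero : ∀ k, MvPolynomial.eval 0 (member (f k) 0) = 0)
    (hf : HasConstantBoundary f)
    (hnd : ∀ K : Finset (Fin k₀), K.Nonempty → IsNonDegenerate (fun k => member (f k) 0) K) :
    0 ∉ closure (singularPoints f) := by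
  classical
  intro hcl
  rw [mem_closure_iff_ultrafilter] at hcl
  obtain ⟨𝒰, hS, h𝒰⟩ := hcl
  have hev : ∀ᶠ x in (𝒰 : Filter _), x ∈ singularPoints f := hS
  -- For `k₀ = 0` the product is 1, which the bound `1 / 2` excludes.
  have hk₀ : Nonempty (Fin k₀) := by
    obtain ⟨x, hx⟩ := hev.exists
    by_contra hempty
    rw [not_nonempty_iff] at hempty
    have := hx.2.1
    norm_num [Finset.univ_eq_empty] at this
  have ht : Tendsto (fun x : ℂ × EuclideanSpace ℂ (Fin n) => x.1) 𝒰 (𝓝 0) :=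
    (continuous_fst.tendsto _).mono_left h𝒰
  have hz : ∀ i, Tendsto (fun x : ℂ × EuclideanSpace ℂ (Fin n) => x.2.ofLp i) 𝒰 (𝓝 0) := by
    intro i
    have hc : Continuous fun x : ℂ × EuclideanSpace ℂ (Fin n) => x.2.ofLp i := by fun_prop
    exact (hc.tendsto 0).mono_left h𝒰
  have hne : ∀ᶠ x in (𝒰 : Filter (ℂ × EuclideanSpace ℂ (Fin n))), ∀ k,
      MvPolynomial.eval x.2.ofLp (member (f k) x.1) ≠ 0 := by
    filter_upwards [hev] with x hx k
    have := hx.1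
    rw [map_prod] at this
    exact Finset.prod_ne_zero_iff.1 this k (Finset.mem_univ k)
  obtain ⟨w, a, α, s, hw, ha, hs, hα, hαmin, hlim⟩ :=
    hf.exists_leading_terms 𝒰 (fun x => x.1) (fun x => x.2.ofLp) ht hz hne
  let G : Fin k₀ → ℂ × EuclideanSpace ℂ (Fin n) → ℂ := fun k x =>
    MvPolynomial.eval x.2.ofLp (member (f k) x.1) / s k x
  let D : Fin k₀ → Fin n → ℂ × EuclideanSpace ℂ (Fin n) → ℂ := fun k i x =>
    x.2.ofLp i * MvPolynomial.eval x.2.ofLp (MvPolynomial.pderiv i (member (f k) x.1)) / s k x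
  have hface : ∀ k, (faceFunction w (member (f k) 0)).support ⊆ (f k).support := by
    intro k β hβ
    refine support_member_subset _ 0 ?_
    rw [MvPolynomial.mem_support_iff, coeff_faceFunction w _ (hα k) (hαmin k)] at hβ
    rw [MvPolynomial.mem_support_iff]
    split_ifs at hβ with h
    · exact hβ
    · exact absurd rfl hβ
  have hG : ∀ k, Tendsto (G k) 𝒰
      (𝓝 (MvPolynomial.eval a (faceFunction w (member (f k) 0)))) := by
    intro k
    rw [eval_eq_sum_of_support_subset _ (hface k)]
    refine (tendsto_finsetSum _ fun β hβ => hlim k β hβ).congr fun x => ?_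
    simp only [G]
    rw [eval_eq_sum_of_support_subset _ (support_member_subset (f k) x.1), Finset.sum_div]
  have hD : ∀ k i, Tendsto (D k i) 𝒰 (𝓝 (a i *
      MvPolynomial.eval a (MvPolynomial.pderiv i (faceFunction w (member (f k) 0))))) := by
    intro k i
    rw [mul_eval_pderiv_eq_sum _ (hface k)]
    refine (tendsto_finsetSum _ fun β hβ => (hlim k β hβ).const_mul (β i : ℂ)).congr fun x => ?_
    simp only [D]
    rw [mul_eval_pderiv_eq_sum _ (support_member_subset (f k) x.1), Finset.sum_div]
    exact Finset.sum_congr rfl fun β _ => by ring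
  have hG0 : ∀ᶠ x in (𝒰 : Filter _), ∀ k, G k x ≠ 0 := by
    filter_upwards [hne] with x hx k
    exact div_ne_zero (hx k) (hs k x)
  obtain ⟨k₁, ρ, hρ1, hρ⟩ := exists_tendsto_div 𝒰 G hG0
  -- the limit of the logarithmic differential of the product
  have hsum : ∀ i, ∑ k, ρ k * (a i *
      MvPolynomial.eval a (MvPolynomial.pderiv i (faceFunction w (member (f k) 0)))) = 0 := by
    intro i
    refine tendsto_nhds_unique (tendsto_finsetSum _ fun k _ => (hρ k).mul (hD k i))
      (tendsto_const_nhds.congr' ?_)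
    filter_upwards [hev, hne] with x hx hx0
    have h1 := eval_pderiv_prod Finset.univ (fun k => member (f k) x.1) x.2.ofLp
      (fun k _ => hx0 k) i
    rw [hx.2.2 i, eq_comm, mul_eq_zero, or_iff_right hx.1] at h1
    have h2 : ∀ k, G k₁ x / G k x * D k i x = G k₁ x * x.2.ofLp i *
        (MvPolynomial.eval x.2.ofLp (MvPolynomial.pderiv i (member (f k) x.1)) /
          MvPolynomial.eval x.2.ofLp (member (f k) x.1)) := by
      intro k
      have h3 := hx0 k
      have h4 := hs k x
      simp only [G, D]
      field_simp
    rw [Finset.sum_congr rfl fun k _ => h2 k, ← Finset.mul_sum, h1, mul_zero]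
  have hρA : ∀ k, ρ k * MvPolynomial.eval a (faceFunction w (member (f k) 0)) =
      MvPolynomial.eval a (faceFunction w (member (f k₁) 0)) := by
    intro k
    refine tendsto_nhds_unique ((hρ k).mul (hG k)) ((hG k₁).congr' ?_)
    filter_upwards [hG0] with x hx
    rw [div_mul_cancel₀ _ (hx k)]
  by_cases hA : MvPolynomial.eval a (faceFunction w (member (f k₁) 0)) = 0
  · let K : Finset (Fin k₀) :=
      {k | MvPolynomial.eval a (faceFunction w (member (f k) 0)) = 0}
    have hk₁ : k₁ ∈ K := by simp [K, hA]
    have hind := hnd K ⟨k₁, hk₁⟩ w hw a ha fun k hk => by simpa [K] using hk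
    -- By `hρA`, `ρ k` vanishes outside `K`, so `hsum` restricts to a relation over `K`.
    have h0 := Fintype.linearIndependent_iff.1 hind (fun k => ρ k) (by
      ext i
      simp only [Finset.sum_apply, Pi.smul_apply, smul_eq_mul, Pi.zero_apply]
      rw [Finset.sum_coe_sort K (fun k => ρ k *
        MvPolynomial.eval a (MvPolynomial.pderiv i (faceFunction w (member (f k) 0))))]
      rw [Finset.sum_subset (Finset.subset_univ K)]
      · have h1 := hsum i
        simp only [mul_left_comm _ (a i)] at h1
        rw [← Finset.mul_sum] at h1
        exact (mul_eq_zero.1 h1).resolve_left (ha i)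
      · intro k _ hk
        have h1 := hρA k
        rw [hA] at h1
        rw [(mul_eq_zero.1 h1).resolve_right (by simpa [K] using hk), zero_mul])
    have := h0 ⟨k₁, hk₁⟩
    simp only [hρ1] at this
    exact one_ne_zero this
  -- Weighting `hsum` by `w` and using Euler's identity and `hρA` leaves the sum of the minimal
  -- weights times a non-zero number.
  · have h1 : ∑ k, ρ k * (((∑ i, w i * α k i : ℕ) : ℂ) *
        MvPolynomial.eval a (faceFunction w (member (f k) 0))) = 0 := by
      simp only [← sum_mul_eval_pderiv_faceFunction w _ (hα _) (hαmin _) a, Finset.mul_sum]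
      rw [Finset.sum_comm]
      refine Finset.sum_eq_zero fun i _ => ?_
      simp only [mul_left_comm _ (w i : ℂ)]
      rw [← Finset.mul_sum, hsum i, mul_zero]
    simp only [mul_left_comm (ρ _), hρA] at h1
    rw [← Finset.sum_mul, mul_eq_zero, or_iff_left hA] at h1
    have h2 : ∑ k, ∑ i, w i * α k i = 0 := by exact_mod_cast h1
    have h3 : ∑ i, w i * α k₁ i = 0 := Finset.sum_eq_zero_iff.1 h2 k₁ (Finset.mem_univ _)
    have h4 : α k₁ = 0 := by
      ext i
      have := Finset.sum_eq_zero_iff.1 h3 i (Finset.mem_univ _)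
      exact (Nat.mul_eq_zero.1 this).resolve_left (hw i).ne'
    have h5 := hα k₁
    rw [h4, MvPolynomial.mem_support_iff, ← MvPolynomial.constantCoeff_eq] at h5
    exact h5 (by rw [← MvPolynomial.eval_zero]; exact hzero k₁)

theorem HasConstantBoundary.hasUniformlyNonsingularFibres {k₀ : ℕ}
    {f : Fin k₀ → MvPolynomial (Fin n) (Polynomial ℂ)} (hf : HasConstantBoundary f)
    (hzero : ∀ k, MvPolynomial.eval 0 (member (f k) 0) = 0)
    (hnd : IsNonDegenerateFamily f) : HasUniformlyNonsingularFibres f := by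
  have h := zero_notMem_closure_singularPoints hzero hf hnd.self_of_nhds
  rw [Metric.mem_closure_iff] at h
  push Not at h
  obtain ⟨ε, hε, h⟩ := h
  -- Since `‖t‖ ≤ τ` is not strict, `τ` is halved to keep `t` strictly within `ε`; the ball for `z`
  -- is already open.
  refine ⟨1 / 2, ε / 2, ε, by norm_num, half_pos hε, hε, fun η t hη hη' ht z hz hev => ?_⟩
  have hprod : member (∏ k, f k) t = ∏ k, member (f k) t := by simp [member, map_prod]
  rw [map_sub, MvPolynomial.eval_C, sub_eq_zero, hprod] at hev
  by_contra! hcon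
  have hmem : (t, z) ∈ singularPoints f := by
    refine ⟨by rw [hev]; exact norm_pos_iff.1 hη, by rw [hev]; exact hη', fun i => ?_⟩
    have := hcon i
    rwa [map_sub, MvPolynomial.pderiv_C, sub_zero, hprod] at this
  have hdist := h _ hmem
  rw [dist_comm, dist_zero_right, Prod.norm_mk] at hdist
  refine absurd hdist (not_le.2 (max_lt (by linarith) (by simpa using hz)))

end Newton

/-- The second conjunct is the same conclusion without uniform local tameness. -/
theorem proposition4p3 (n k₀ : ℕ) (f : Fin k₀ → MvPolynomial (Fin n) (Polynomial ℂ))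
    (hconst : ∀ k, ¬ ∃ c : ℂ, ∀ (t : ℂ) (z : Fin n → ℂ),
      MvPolynomial.eval z (Newton.member (f k) t) = c)
    (hzero : ∀ (k : Fin k₀) (t : ℂ), MvPolynomial.eval 0 (Newton.member (f k) t) = 0) :
    (Newton.IsAdmissible f → Newton.HasUniformlyNonsingularFibres f) ∧
    (Newton.HasConstantBoundary f → Newton.IsNonDegenerateFamily f →
      Newton.HasUniformlyNonsingularFibres f) := by
  have key : Newton.HasConstantBoundary f → Newton.IsNonDegenerateFamily f →
      Newton.HasUniformlyNonsingularFibres f := fun hb hnd =>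
    hb.hasUniformlyNonsingularFibres (fun k => hzero k 0) hnd
  exact ⟨fun h => key h.1 h.2.1, key⟩
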